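/- Conventions. A \emph{partially ordered group} $(\Gamma,\le)$ is a (not necessarily commutative, additively written) group with a partial order such that $\alpha\le\gamma$ and $\beta\le\delta$ imply $\alpha+\beta\le\gamma+\delta$. Let $D$ be a division ring, $N\le D^\times$ a subgroup and $\varphi\colon N\to\Gamma$ a group homomorphism to a partially ordered group. Put $N_{>\alpha}=\{x\in N:\varphi(x)>\alpha\}$ and $N_{\le\alpha}=\{x\in N:\varphi(x)\le\alpha\}$. The map $\varphi$ is \emph{strongly leveled} if there is $\alpha\in\Gamma$, $\alpha\ge 0$ (an \emph{s-level} of $\varphi$), such that $N_{>\alpha}\neq\emptyset$ and $1\pm N_{>\alpha}\subseteq N_{\le 0}$. It is \emph{strong valuation-like} if moreover $\Gamma$ is totally ordered. A \emph{valuation} of a field $k$ is a surjective group homomorphism $v\colon k^\times\to\Gamma_v$ onto a totally ordered (commutative) group such that $v(x+y)\ge\min\{v(x),v(y)\}$ whenever $x+y\ne 0$. Its \emph{height} is the supremum of all $r\ge 0$ for which there is a chain $\Gamma_v=\Gamma_0\to\Gamma_1\to\cdots\to\Gamma_r=\{0\}$ of epimorphisms of totally ordered groups, all with non-trivial kernels.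 The \emph{$v$-adic topology} on $k$ is the ring topology in which the sets $\{x\in k^\times: v(x)>\delta\}\cup\{0\}$, $\delta\in\Gamma_v$, $\delta\ge0$, form a basis of neighbourhoods of $0$; $k^\times$ carries the subspace topology. For a subgroup $M\le k^\times$ and a homomorphism $\psi\colon M\to\Gamma$, the valuation $v$ is \emph{associated} with $\psi$ if $\psi(m)\ge 0$ implies $v(m)\ge 0$ for all $m\in M$. \textbf{Theorem.} Let $D$ be a finite-dimensional (not necessarily central) division algebra over a field $k$ that has finite transcendence degree over its prime field, and let $N\subseteq D^\times$ be a normal subgroup of finite index containing $-1$. Let $\varphi\colon N\to\Gamma$ be a strongly leveled map to a partially ordered group $(\Gamma,\le)$ such that the subgroup $\varphi(N\cap k^\times)$ of $\Gamma$ is totally ordered. Then: (a) the restriction $\varphi_k=\varphi|_{N\cap k^\times}$, regarded as a map to the totally ordered group $\varphi(N\cap k^\times)$, is a strong valuation-like map (in particular it has an s-level in $\varphi(N\cap k^\times)$); (b) there exists a height one valuation $v$ of $k$ associated with $\varphi_k$ such that $N\cap k^\times$ is open in $k^\times$ in the $v$-adic topology. -/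

import Mathlib

universe u v w

namespace LeveledMap

section Levels

variable {D : Type*} [DivisionRing D] {N : Subgroup Dˣ} {Γ : Type*} [AddGroup Γ] [PartialOrder Γ]

/-- `N_{> α} = {x ∈ N | φ x > α}`, viewed as a subset of the division ring `D`.
The group `N` is written multiplicatively and `Γ` additively, so that a homomorphism from `N`
to `Γ` is a map `Additive N →+ Γ`. -/
def levelGT (φ : Additive N →+ Γ) (α : Γ) : Set D :=
  {x | ∃ n : N, ((n : Dˣ) : D) = x ∧ α < φ (Additive.ofMul n)}

/-- `N_{≤ α} = {x ∈ N | φ x ≤ α}`, viewed as a subset of the division ring `D`. -/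
def levelLE (φ : Additive N →+ Γ) (α : Γ) : Set D :=
  {x | ∃ n : N, ((n : Dˣ) : D) = x ∧ φ (Additive.ofMul n) ≤ α}

/-- `α` is an s-level of `φ`: it is non-negative, `N_{> α}` is non-empty and
`1 ± N_{> α} ⊆ N_{≤ 0}`. -/
def IsSLevel (φ : Additive N →+ Γ) (α : Γ) : Prop :=
  0 ≤ α ∧ (levelGT φ α).Nonempty ∧
    ∀ x ∈ levelGT φ α, 1 + x ∈ levelLE φ 0 ∧ 1 - x ∈ levelLE φ 0

/-- Strongly leveled maps. -/
def IsStronglyLeveled (φ : Additive N →+ Γ) : Prop :=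
  ∃ α : Γ, IsSLevel φ α

/-- Strong valuation-like maps: strongly leveled maps to a totally ordered group. -/
def IsStrongValuationLike (φ : Additive N →+ Γ) : Prop :=
  (∀ a b : Γ, a ≤ b ∨ b ≤ a) ∧ IsStronglyLeveled φ

end Levels

section BaseField

variable (k : Type*) [Field k] {D : Type*} [DivisionRing D] [Algebra k D]

/-- The embedding `kˣ → Dˣ` of unit groups, for a `k`-algebra `D`. -/
def unitsMap : kˣ →* Dˣ :=
  Units.map (algebraMap k D : k →* D)

/-- `N ∩ kˣ`, as a subgroup of `kˣ`. -/
def interBase (N : Subgroup Dˣ) : Subgroup kˣ :=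
  N.comap (unitsMap k)

/-- The restriction of `φ : N → Γ` to `N ∩ kˣ`, with values in `Γ`. -/
def restrictBase {N : Subgroup Dˣ} {Γ : Type*} [AddGroup Γ] (φ : Additive N →+ Γ) :
    Additive (interBase k N) →+ Γ :=
  φ.comp (MonoidHom.toAdditive ((unitsMap k).subgroupComap N))

end BaseField

/-- There is a chain of `r` epimorphisms of totally ordered commutative groups
`Γ = Γ₀ → Γ₁ → ⋯ → Γᵣ = {1}`, each with a non-trivial kernel. -/
def HasHeightChain : ℕ → ∀ (Γ : Type u) [CommGroup Γ] [LinearOrder Γ], Prop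
  | 0, Γ, _, _ => Subsingleton Γ
  | r + 1, Γ, _, _ =>
    ∃ (Γ' : Type u) (_ : CommGroup Γ') (_ : LinearOrder Γ') (_ : IsOrderedMonoid Γ') (μ : Γ →* Γ'),
      Monotone μ ∧ Function.Surjective μ ∧ μ.ker ≠ ⊥ ∧ HasHeightChain r Γ'

/-- The height (rank) of a totally ordered commutative group: the supremum of the lengths of
such chains. -/
noncomputable def height (Γ : Type u) [CommGroup Γ] [LinearOrder Γ] : ℕ∞ :=
  ⨆ (r : ℕ) (_ : HasHeightChain r Γ), (r : ℕ∞)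

section Valuations

/-! Mathlib's valuations are written multiplicatively, with the reversed order: `v x ≥ 0` and
`v (x + y) ≥ min (v x) (v y)` in additive notation read `v x ≤ 1` and
`v (x + y) ≤ max (v x) (v y)`.  For a surjective valuation `v : Valuation k Γ₀` the
value group is `Γ₀ˣ`; reversing the order of a group does not affect its height. -/

variable {k : Type*} [Field k] {Γ₀ : Type*} [LinearOrderedCommGroupWithZero Γ₀]

/-- `v` is associated with `φ : N → Γ`: `φ n ≥ 0` implies `v n ≥ 0` (additively). -/
def IsAssociated (v : Valuation k Γ₀) {N : Subgroup kˣ} {Γ : Type*} [AddGroup Γ] [PartialOrder Γ]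
    (φ : Additive N →+ Γ) : Prop :=
  ∀ n : N, 0 ≤ φ (Additive.ofMul n) → v ((n : kˣ) : k) ≤ 1

/-- `S ⊆ kˣ` is open in the `v`-adic topology of `kˣ`, i.e. in the subspace topology coming from
the `v`-adic topology of `k`, in which the sets `{x | v x < γ}`, with `γ` in the value group, form a
basis of neighbourhoods of zero. -/
def IsAdicallyOpen (v : Valuation k Γ₀) (S : Set kˣ) : Prop :=
  @IsOpen kˣ (TopologicalSpace.induced (fun x : kˣ => (x : k)) v.subgroups_basis.topology) S

end Valuations

end LeveledMap

/-!
Let `I` be the additive span of `N_{> α}`, a left module over the ring generated by `N_{≥ 0}`.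
Adding generators one at a time turns the s-level condition into `1 + I ⊆ N_{≤ 0}`, so `1 ∉ I`.
The constant term of an algebraic equation satisfied by an element of `N_{> α}` is a non-zero
element of `I ∩ k`. A subgroup of finite index of `kˣ` generates `k` as a ring, so that element
can be multiplied into `N ∩ kˣ`, which gives the s-level of `ψ = φ_k`.

If `e` is the index of `N ∩ kˣ`, then `x ↦ ψ (x ^ e)` extends `e • ψ` to all of `kˣ` with totally
ordered image. The ring `R` generated by its non-negative elements is therefore a valuation ring,
and finiteness of the number of cosets gives `t ≠ 0` with `1 + R t ⊆ N ∩ kˣ`; every proper overring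
of `R` then works for openness.

Some overring of `R` is maximal among the proper ones, i.e. of height one. If the valuation is
trivial on a subfield `F`, an element of a larger ring `W` outside the smaller one is transcendental
over `F`, and `W` is trivial on the larger field it generates, so the transcendence degree drops.
If no proper overring is trivial on the prime field, all of them exclude the inverse of the same
prime number, and Zorn's lemma applies.
-/

namespace LeveledMap

open IntermediateField Polynomial Cardinal

section ValuationRings

variable {k : Type u} [Field k]

theorem isTrivialOn_valuation_of_forall_mem {F : Type*} [Field F] [Algebra F k]
    {V : ValuationSubring k} (h : ∀ a : F, algebraMap F k a ∈ V) : V.valuation.IsTrivialOn F where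
  eq_one a ha := by
    have hinv := (V.valuation_le_one_iff _).2 (h a⁻¹)
    rw [map_inv₀, map_inv₀] at hinv
    refine le_antisymm ((V.valuation_le_one_iff _).2 (h a)) ((inv_le_one₀ ?_).1 hinv)
    simpa [zero_lt_iff] using ha

theorem isTrivialOn_adjoin_simple {F : Type*} [Field F] [Algebra F k] {V W : ValuationSubring k}
    [V.valuation.IsTrivialOn F] (hVW : V ≤ W) {x : k} (hxV : x ∉ V) (hxW : x ∈ W) :
    W.valuation.IsTrivialOn F⟮x⟯ := by
  have hx : 1 < V.valuation x := by rwa [← not_le, V.valuation_le_one_iff]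
  have hWx : W.valuation x = 1 := by
    refine le_antisymm ((W.valuation_le_one_iff x).2 hxW) ?_
    have hinv := (W.valuation_le_one_iff _).2 (hVW ((V.mem_or_inv_mem x).resolve_left hxV))
    rw [map_inv₀] at hinv
    refine (inv_le_one₀ (zero_lt_iff.2 ((W.valuation.ne_zero_iff).2 ?_))).1 hinv
    rintro rfl
    exact hxV (zero_mem V)
  have haeval {p : F[X]} (hp : p ≠ 0) : W.valuation (aeval x p) = 1 := by
    have h := valuation_aeval_eq_valuation_X_pow_natDegree_of_one_lt_valuation_X x hx hp
    rw [← V.mapOfLE_valuation_apply W hVW, h, map_pow, V.mapOfLE_valuation_apply, hWx, one_pow]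
  refine isTrivialOn_valuation_of_forall_mem fun z ↦ (W.valuation_le_one_iff _).1 ?_
  obtain ⟨p, q, hz⟩ := (IntermediateField.mem_adjoin_simple_iff F _).1 z.2
  rw [IntermediateField.algebraMap_apply, hz, map_div₀]
  rcases eq_or_ne p 0 with rfl | hp
  · simp
  rcases eq_or_ne q 0 with rfl | hq
  · simp
  · rw [haeval hp, haeval hq, div_one]

theorem trdeg_adjoin_simple_lt {F K : Type*} [Field F] [Field K] [Algebra F K] {x : K}
    (hx : Transcendental F x) (htr : Algebra.trdeg F K < ℵ₀) :
    Algebra.trdeg F⟮x⟯ K < Algebra.trdeg F K := by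
  have hadd := trdeg_add_eq F F⟮x⟯ (A := K)
  have hfin : Algebra.trdeg F⟮x⟯ K < ℵ₀ := (self_le_add_left _ _).trans_lt (hadd.trans_lt htr)
  have hpos : Algebra.trdeg F F⟮x⟯ ≠ 0 :=
    trdeg_ne_zero_iff.2 ⟨AdjoinSimple.gen F x, fun h ↦ hx (by simpa using h.algebraMap (A := K))⟩
  rw [← hadd]
  simpa using (add_lt_add_iff_of_right_lt_aleph0 hfin).2 (pos_iff_ne_zero.2 hpos)

theorem exists_le_isCoatom_of_isTrivialOn (F : Type u) [Field F] [Algebra F k]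
    (htr : Algebra.trdeg F k < ℵ₀) (V : ValuationSubring k) [V.valuation.IsTrivialOn F]
    (hV : V ≠ ⊤) : ∃ W, V ≤ W ∧ IsCoatom W := by
  by_cases hcoatom : IsCoatom V
  · exact ⟨V, le_rfl, hcoatom⟩
  obtain ⟨W, hVW, hW⟩ : ∃ W, V < W ∧ W ≠ ⊤ := by simpa [IsCoatom, hV] using hcoatom
  obtain ⟨x, hxW, hxV⟩ := SetLike.exists_of_lt hVW
  have hx : Transcendental F x := by
    refine Valuation.transcendental_of_ne_one (v := V.valuation) F x ?_ ?_
    · rintro rfl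
      exact hxV (zero_mem V)
    · exact fun h ↦ hxV ((V.valuation_le_one_iff x).1 h.le)
  have hlt := trdeg_adjoin_simple_lt hx htr
  have := isTrivialOn_adjoin_simple (F := F) hVW.le hxV hxW
  obtain ⟨U, hWU, hU⟩ := exists_le_isCoatom_of_isTrivialOn F⟮x⟯ (hlt.trans htr) W hW
  exact ⟨U, hVW.le.trans hWU, hU⟩
termination_by Algebra.trdeg F k

theorem isTrivialOn_primeField {V : ValuationSubring k}
    (hV : ∀ p : ℕ, p.Prime → (p : k)⁻¹ ∈ V) : V.valuation.IsTrivialOn (⊥ : Subfield k) := by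
  have hnat (n : ℕ) : (n : k)⁻¹ ∈ V := by
    induction n using Nat.recOnMul with
    | zero => simp
    | one => simp
    | prime p hp => exact hV p hp
    | mul a b ha hb => simpa only [Nat.cast_mul, mul_inv] using mul_mem ha hb
  refine isTrivialOn_valuation_of_forall_mem fun ⟨y, hy⟩ ↦ ?_
  rw [← Subfield.closure_empty, Subfield.mem_closure_iff, Subring.closure_empty] at hy
  obtain ⟨_, ⟨a, rfl⟩, _, ⟨b, rfl⟩, rfl⟩ := hy
  change (a : k) / (b : k) ∈ V
  rw [div_eq_mul_inv]
  refine mul_mem (intCast_mem V a) ?_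
  obtain ⟨n, rfl | rfl⟩ := b.eq_nat_or_neg
  · simpa using hnat n
  · simpa [inv_neg] using hnat n

theorem prime_eq_of_inv_notMem {V : ValuationSubring k} {p q : ℕ} (hp : p.Prime) (hq : q.Prime)
    (hpV : (p : k)⁻¹ ∉ V) (hqV : (q : k)⁻¹ ∉ V) : p = q := by
  by_contra hpq
  obtain ⟨a, b, hab⟩ := Nat.isCoprime_iff_coprime.2 ((Nat.coprime_primes hp hq).2 hpq)
  have hmul (c : ℤ) {x : k} (hx : x⁻¹ ∉ V) : (c : k) * x ∈ V.nonunits := by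
    rw [← zsmul_eq_mul]
    exact zsmul_mem (V.mem_nonunits_iff_or.2 (.inr hx)) c
  have hone : (1 : k) ∈ V.nonunits := by
    have h : (a : k) * p + b * q = 1 := by exact_mod_cast congrArg (Int.cast : ℤ → k) hab
    exact h ▸ add_mem (hmul a hpV) (hmul b hqV)
  simp [ValuationSubring.mem_nonunits_iff] at hone

theorem exists_maximal_notMem {R : ValuationSubring k} {y : k} (hy : y ∉ R) :
    ∃ V, R ≤ V ∧ Maximal (y ∉ ·) V := by
  obtain ⟨S, hRS, hS⟩ := zorn_le_nonempty₀ {S : Subring k | y ∉ S} (fun c hc hchain T hT ↦ by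
    refine ⟨sSup c, ?_, fun S hS ↦ le_sSup hS⟩
    rw [Set.mem_ofPred_eq, Subring.mem_sSup_of_directedOn ⟨T, hT⟩ hchain.directedOn]
    rintro ⟨S, hS, hyS⟩
    exact hc hS hyS) R.toSubring hy
  exact ⟨.ofLE R S hRS, hRS, hS.prop, fun W hW hVW ↦ hS.le_of_ge (y := W.toSubring) hW hVW⟩

theorem exists_le_isCoatom (hk : Algebra.trdeg (⊥ : Subfield k) k < ℵ₀)
    {R : ValuationSubring k} (hR : R ≠ ⊤) : ∃ V, R ≤ V ∧ IsCoatom V := by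
  by_cases htriv : ∃ V, R ≤ V ∧ V ≠ ⊤ ∧ V.valuation.IsTrivialOn (⊥ : Subfield k)
  · obtain ⟨V, hRV, hV, _⟩ := htriv
    obtain ⟨W, hVW, hW⟩ := exists_le_isCoatom_of_isTrivialOn _ hk V hV
    exact ⟨W, hRV.trans hVW, hW⟩
  have hprime {V : ValuationSubring k} (hRV : R ≤ V) (hV : V ≠ ⊤) :
      ∃ p : ℕ, p.Prime ∧ (p : k)⁻¹ ∉ V := by
    contrapose! htriv
    exact ⟨V, hRV, hV, isTrivialOn_primeField htriv⟩
  obtain ⟨p, hp, hpR⟩ := hprime le_rfl hR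
  obtain ⟨V, hRV, hV⟩ := exists_maximal_notMem hpR
  refine ⟨V, hRV, fun h ↦ hV.prop (h ▸ ValuationSubring.mem_top _), fun W hVW ↦ ?_⟩
  by_contra hW
  obtain ⟨q, hq, hqW⟩ := hprime (hRV.trans hVW.le) hW
  obtain rfl := prime_eq_of_inv_notMem hp hq hV.prop fun h ↦ hqW (hVW.le h)
  exact hV.not_prop_of_gt hVW hqW

/-- The overring of `V` whose elements have value at most a power of `a`; its coarsening of the
valuation is the one that makes `a` a unit. -/
def powBoundedSubring (V : ValuationSubring k) {a : V.ValueGroup} (ha : 1 < a) : Subring k where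
  carrier := {x | ∃ n : ℕ, V.valuation x ≤ a ^ n}
  mul_mem' := by
    rintro x y ⟨m, hm⟩ ⟨n, hn⟩
    exact ⟨m + n, by simpa only [map_mul, pow_add] using mul_le_mul' hm hn⟩
  one_mem' := ⟨0, by simp⟩
  add_mem' := by
    rintro x y ⟨m, hm⟩ ⟨n, hn⟩
    refine ⟨max m n, V.valuation.map_add_le (hm.trans ?_) (hn.trans ?_)⟩
    · exact pow_le_pow_right₀ ha.le (le_max_left m n)
    · exact pow_le_pow_right₀ ha.le (le_max_right m n)
  zero_mem' := ⟨0, by simp⟩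
  neg_mem' := fun ⟨n, hn⟩ ↦ ⟨n, by rwa [Valuation.map_neg]⟩

theorem mulArchimedean_valueGroup_of_isCoatom {V : ValuationSubring k} (hV : IsCoatom V) :
    MulArchimedean V.ValueGroup where
  arch b a ha := by
    obtain ⟨x, rfl⟩ := V.valuation_surjective a
    obtain ⟨y, rfl⟩ := V.valuation_surjective b
    have hle : V.toSubring ≤ powBoundedSubring V ha := fun z hz ↦
      ⟨0, by simpa using (V.valuation_le_one_iff z).2 hz⟩
    have hx : x ∈ powBoundedSubring V ha := ⟨1, by simp⟩
    have hlt : V < .ofLE V _ hle := SetLike.lt_iff_le_and_exists.2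
      ⟨hle, x, hx, fun hxV ↦ ha.not_ge ((V.valuation_le_one_iff x).2 hxV)⟩
    have hy : y ∈ ValuationSubring.ofLE V _ hle := hV.2 _ hlt ▸ ValuationSubring.mem_top y
    exact hy

theorem nontrivial_units_valueGroup {V : ValuationSubring k} (hV : V ≠ ⊤) :
    Nontrivial V.ValueGroupˣ := by
  obtain ⟨x, -, hx⟩ := SetLike.exists_of_lt (lt_top_iff_ne_top.2 hV)
  have h1 : V.valuation x ≠ 1 := fun h ↦ hx ((V.valuation_le_one_iff x).1 h.le)
  have h0 : V.valuation x ≠ 0 := (V.valuation.ne_zero_iff).2 fun h ↦ hx (h ▸ zero_mem V)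
  exact ⟨Units.mk0 _ h0, 1, fun h ↦ h1 (congrArg Units.val h)⟩

end ValuationRings

section Height

theorem subsingleton_of_monotone_of_ker_ne_bot {Γ Γ' : Type*} [CommGroup Γ] [LinearOrder Γ]
    [IsOrderedMonoid Γ] [MulArchimedean Γ] [CommGroup Γ'] [LinearOrder Γ'] {μ : Γ →* Γ'}
    (hmono : Monotone μ) (hsurj : Function.Surjective μ) (hker : μ.ker ≠ ⊥) :
    Subsingleton Γ' := by
  obtain ⟨⟨a, ha⟩, hne⟩ := Subgroup.ne_bot_iff_exists_ne_one.1 hker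
  have ha1 : 1 < |a|ₘ := one_lt_mabs.2 fun h ↦ hne (Subtype.ext h)
  have hμa : μ |a|ₘ = 1 := by
    rcases mabs_choice a with h | h
    · rw [h, ha]
    · rw [h, map_inv, ha, inv_one]
  have hle (b : Γ) : μ b ≤ 1 := by
    obtain ⟨n, hn⟩ := MulArchimedean.arch b ha1
    simpa [hμa] using hmono hn
  have hge (b : Γ) : 1 ≤ μ b := by
    obtain ⟨n, hn⟩ := MulArchimedean.arch b⁻¹ ha1
    simpa [hμa] using hmono (inv_le_of_inv_le' hn)
  exact subsingleton_of_forall_eq 1 (hsurj.forall.2 fun b ↦ (hle b).antisymm (hge b))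

theorem height_eq_one {Γ : Type u} [CommGroup Γ] [LinearOrder Γ] [IsOrderedMonoid Γ]
    [MulArchimedean Γ] [Nontrivial Γ] : height Γ = 1 := by
  refine le_antisymm (iSup₂_le fun r hr ↦ ?_) ?_
  · match r, hr with
    | 0, _ => simp
    | 1, _ => simp
    | r + 2, ⟨_, _, _, _, _, hmono, hsurj, hker, _, _, _, _, _, _, _, hker', _⟩ =>
      have := subsingleton_of_monotone_of_ker_ne_bot hmono hsurj hker
      exact absurd (Subsingleton.elim _ _) hker'
  · refine le_iSup₂_of_le (f := fun r (_ : HasHeightChain r Γ) ↦ (r : ℕ∞)) 1 ?_ (by simp)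
    refine ⟨PUnit, inferInstance, inferInstance, ⟨fun _ _ _ _ ↦ le_rfl, fun _ _ _ _ ↦ le_rfl⟩, 1,
      fun _ _ _ ↦ le_rfl, fun _ ↦ ⟨1, rfl⟩, by simp, inferInstanceAs (Subsingleton PUnit)⟩

end Height

theorem isAdicallyOpen_of_forall_sub_one_lt {k : Type*} [Field k] {Γ₀ : Type*}
    [LinearOrderedCommGroupWithZero Γ₀] {v : Valuation k Γ₀} {M : Subgroup kˣ} {c : k} (hc : c ≠ 0)
    (h : ∀ x : kˣ, v ((x : k) - 1) < v c → x ∈ M) : IsAdicallyOpen v (M : Set kˣ) := by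
  let _ : Valued k Γ₀ := Valued.mk' v
  let _ : TopologicalSpace kˣ := .induced (fun x ↦ (x : k)) inferInstance
  refine isOpen_iff_mem_nhds.2 fun x hx ↦ ?_
  have hγ : v.restrict (x * c) ≠ 0 := by simpa using hc
  rw [nhds_induced, Filter.mem_comap]
  refine ⟨{y | v.restrict (y - x) < v.restrict (x * c)},
    (Valued.mem_nhds).2 ⟨Units.mk0 _ hγ, fun _ hy ↦ hy⟩, fun y hy ↦ ?_⟩
  have hyx : v ((y : k) - x) < v (x * c) := (Valuation.restrict_lt_iff v).1 hy
  have hquot : x⁻¹ * y ∈ M := by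
    refine h _ ?_
    have heq : ((x⁻¹ * y : kˣ) : k) - 1 = (x : k)⁻¹ * (y - x) := by
      simp [mul_sub]
    have hpos : 0 < v (x : k) := by simp [zero_lt_iff]
    rwa [heq, map_mul, map_inv₀, inv_mul_lt_iff₀ hpos, ← map_mul]
  simpa using mul_mem hx hquot

section FiniteIndex

variable {k : Type*} [Field k] [Infinite k] (M : Subgroup kˣ) [M.FiniteIndex]

theorem infinite_of_finiteIndex : Infinite M := by
  have : Infinite kˣ :=
    unitsEquivNeZero.infinite_iff.2 (Set.finite_singleton (0 : k)).infinite_compl.to_subtype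
  by_contra hM
  have hfin : Finite kˣ := (Subgroup.finite_iff_finite_and_finiteIndex M).2
    ⟨not_infinite_iff_finite.1 hM, inferInstance⟩
  exact not_finite kˣ

/- The cosets of `M` lie on finitely many lines over `K`, and a vector space over an infinite field
is not a finite union of proper subspaces. -/
theorem subfield_eq_top_of_finiteIndex {K : Subfield k} (hMK : ∀ m ∈ M, (m : k) ∈ K) : K = ⊤ := by
  have hK : Infinite K := by
    have := infinite_of_finiteIndex M
    refine Infinite.of_injective (fun m : M ↦ (⟨_, hMK m m.2⟩ : K)) fun m n h ↦ ?_
    exact Subtype.ext (Units.ext (congrArg Subtype.val h))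
  have hcover : ⋃ q : kˣ ⧸ M, (K ∙ ((q.out : kˣ) : k) : Set k) = Set.univ := by
    refine Set.eq_univ_of_forall fun x ↦ Set.mem_iUnion.2 ?_
    rcases eq_or_ne x 0 with rfl | hx
    · exact ⟨1, zero_mem _⟩
    obtain ⟨m, hm⟩ := QuotientGroup.mk_out_eq_mul M (Units.mk0 x hx)
    refine ⟨Units.mk0 x hx, Submodule.mem_span_singleton.2 ⟨⟨_, hMK _ (inv_mem m.2)⟩, ?_⟩⟩
    simp [hm, Subfield.smul_def, mul_left_comm]
  obtain ⟨q, hq⟩ := Subspace.exists_eq_top_of_iUnion_eq_univ hcover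
  have hmem (x : k) : ∃ a ∈ K, a * (q.out : kˣ) = x := by
    obtain ⟨a, ha⟩ := Submodule.mem_span_singleton.1 (hq ▸ Submodule.mem_top : x ∈ _)
    exact ⟨a, a.2, ha⟩
  obtain ⟨a, haK, ha⟩ := hmem 1
  refine eq_top_iff.2 fun x _ ↦ ?_
  obtain ⟨b, hbK, rfl⟩ := hmem x
  rw [eq_inv_of_mul_eq_one_right ha]
  exact mul_mem hbK (inv_mem haK)

theorem subring_closure_eq_top_of_finiteIndex :
    Subring.closure ((fun u : kˣ ↦ (u : k)) '' M) = ⊤ := by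
  set S := Subring.closure ((fun u : kˣ ↦ (u : k)) '' M)
  have hMS {m : kˣ} (hm : m ∈ M) : (m : k) ∈ S := Subring.subset_closure ⟨m, hm, rfl⟩
  have hinv (s : k) (hs : s ∈ S) : s⁻¹ ∈ S := by
    rcases eq_or_ne s 0 with rfl | hs0
    · simp
    have hpow : s⁻¹ = s ^ (M.index - 1) * ((Units.mk0 s hs0 ^ M.index)⁻¹ : kˣ) := by
      rw [Units.val_inv_eq_inv_val, Units.val_pow_eq_pow_val, Units.val_mk0,
        eq_mul_inv_iff_mul_eq₀ (pow_ne_zero _ hs0), ← mul_pow_sub_one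
        (Subgroup.FiniteIndex.index_ne_zero (H := M)), inv_mul_cancel_left₀ hs0]
    rw [hpow]
    exact mul_mem (pow_mem hs _) (hMS (inv_mem (M.pow_index_mem _)))
  let K : Subfield k := { S with inv_mem' := hinv }
  have hK : K = ⊤ := subfield_eq_top_of_finiteIndex M fun _ hm ↦ hMS hm
  exact eq_top_iff.2 fun x _ ↦ (hK ▸ Subfield.mem_top x : x ∈ K)

end FiniteIndex

section LevelSpan

variable {D : Type*} [DivisionRing D] {N : Subgroup Dˣ} {Γ : Type*} [AddGroup Γ] [PartialOrder Γ]
  {φ : Additive N →+ Γ} {α : Γ}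

/-- The additive subgroup of `D` generated by `N_{> α}`. -/
def levelSpan (φ : Additive N →+ Γ) (α : Γ) : AddSubgroup D :=
  AddSubgroup.closure (levelGT φ α)

/-- The subring of `D` generated by `N_{≥ 0}`, over which each `levelSpan φ α` is a left
module. -/
def nonnegSubring (φ : Additive N →+ Γ) : Subring D :=
  Subring.closure {x | ∃ n : N, ((n : Dˣ) : D) = x ∧ 0 ≤ φ (Additive.ofMul n)}

theorem coe_mem_levelSpan {n : N} (hn : α < φ (Additive.ofMul n)) :
    ((n : Dˣ) : D) ∈ levelSpan φ α :=
  AddSubgroup.subset_closure ⟨n, rfl, hn⟩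

theorem coe_mem_nonnegSubring {n : N} (hn : 0 ≤ φ (Additive.ofMul n)) :
    ((n : Dˣ) : D) ∈ nonnegSubring φ :=
  Subring.subset_closure ⟨n, rfl, hn⟩

theorem zero_notMem_levelLE : (0 : D) ∉ levelLE φ α := fun ⟨n, hn, _⟩ ↦ (n : Dˣ).ne_zero hn

theorem mul_mem_levelLE_zero [AddLeftMono Γ] {x y : D} (hx : x ∈ levelLE φ 0)
    (hy : y ∈ levelLE φ 0) : x * y ∈ levelLE φ 0 := by
  obtain ⟨m, rfl, hm⟩ := hx
  obtain ⟨n, rfl, hn⟩ := hy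
  refine ⟨m * n, by simp, ?_⟩
  rw [ofMul_mul, map_add]
  exact add_nonpos hm hn

theorem IsSLevel.infinite_of_isAlgebraic [AddLeftMono Γ] (hα : IsSLevel φ α) (k : Type*) [Field k]
    [Algebra k D] [Algebra.IsAlgebraic k D] : Infinite k := by
  by_contra hk
  have : Finite k := not_infinite_iff_finite.1 hk
  obtain ⟨hα0, ⟨_, n, rfl, hn⟩, -⟩ := hα
  have hint : IsIntegral k ((n : Dˣ) : D) := Algebra.IsIntegral.isIntegral _
  have : Module.Finite k (Algebra.adjoin k {((n : Dˣ) : D)}) :=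
    .of_fg hint.fg_adjoin_singleton
  have : Finite (Algebra.adjoin k {((n : Dˣ) : D)}) := Module.finite_of_finite k
  refine not_injective_infinite_finite
    (fun i : ℕ ↦ (⟨_, pow_mem (Algebra.self_mem_adjoin_singleton k ((n : Dˣ) : D)) i⟩ :
      Algebra.adjoin k {((n : Dˣ) : D)})) fun i j hij ↦ ?_
  have hpow : n ^ i = n ^ j := by
    ext
    simpa using congrArg Subtype.val hij
  refine (nsmul_left_strictMono (hα0.trans_lt hn)).injective ?_
  simpa using congrArg (fun m : N ↦ φ (Additive.ofMul m)) hpow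

variable [AddRightMono Γ]

theorem coe_mul_mem_levelSpan {n : N} (hn : 0 ≤ φ (Additive.ofMul n)) {y : D}
    (hy : y ∈ levelSpan φ α) : ((n : Dˣ) : D) * y ∈ levelSpan φ α := by
  induction hy using AddSubgroup.closure_induction with
  | mem y hy =>
    obtain ⟨m, rfl, hm⟩ := hy
    refine AddSubgroup.subset_closure ⟨n * m, by simp, ?_⟩
    rw [ofMul_mul, map_add]
    exact lt_add_of_nonneg_of_lt hn hm
  | zero => simp
  | add y z _ _ hy hz => rw [mul_add]; exact add_mem hy hz
  | neg y _ hy => rw [mul_neg]; exact neg_mem hy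

theorem mul_mem_levelSpan {r y : D} (hr : r ∈ nonnegSubring φ) (hy : y ∈ levelSpan φ α) :
    r * y ∈ levelSpan φ α := by
  induction hr using Subring.closure_induction generalizing y with
  | mem r hr =>
    obtain ⟨n, rfl, hn⟩ := hr
    exact coe_mul_mem_levelSpan hn hy
  | zero => simp
  | one => simpa
  | add r s _ _ hr hs => rw [add_mul]; exact add_mem (hr hy) (hs hy)
  | neg r _ hr => rw [neg_mul]; exact neg_mem (hr hy)
  | mul r s _ _ hr hs => rw [mul_assoc]; exact hr (hs hy)

theorem coe_mem_levelSpan_of_le {m n : N} (hm : ((m : Dˣ) : D) ∈ levelSpan φ α)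
    (hmn : φ (Additive.ofMul m) ≤ φ (Additive.ofMul n)) : ((n : Dˣ) : D) ∈ levelSpan φ α := by
  have hquot : 0 ≤ φ (Additive.ofMul (n * m⁻¹)) := by
    rwa [ofMul_mul, ofMul_inv, map_add, map_neg, ← sub_eq_add_neg, sub_nonneg]
  simpa using coe_mul_mem_levelSpan hquot hm

variable [AddLeftMono Γ]

theorem IsSLevel.add_mem_and_sub_mem_levelLE (hα : IsSLevel φ α) {u x : D} (hu : u ∈ levelLE φ 0)
    (hx : x ∈ levelGT φ α) : u + x ∈ levelLE φ 0 ∧ u - x ∈ levelLE φ 0 := by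
  have hu' := hu
  obtain ⟨m, rfl, hm⟩ := hu
  obtain ⟨n, rfl, hn⟩ := hx
  have hquot : (((m⁻¹ * n : N) : Dˣ) : D) ∈ levelGT φ α := by
    refine ⟨_, rfl, ?_⟩
    rw [ofMul_mul, ofMul_inv, map_add, map_neg]
    exact lt_add_of_nonneg_of_lt (neg_nonneg.2 hm) hn
  obtain ⟨hadd, hsub⟩ := hα.2.2 _ hquot
  constructor
  · simpa [mul_add] using mul_mem_levelLE_zero hu' hadd
  · simpa [mul_sub] using mul_mem_levelLE_zero hu' hsub

theorem IsSLevel.add_mem_levelLE (hα : IsSLevel φ α) {u y : D} (hu : u ∈ levelLE φ 0)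
    (hy : y ∈ levelSpan φ α) : u + y ∈ levelLE φ 0 := by
  suffices h : ∀ u ∈ levelLE φ 0, u + y ∈ levelLE φ 0 ∧ u - y ∈ levelLE φ 0 from (h u hu).1
  clear hu
  induction hy using AddSubgroup.closure_induction with
  | mem y hy => exact fun u hu ↦ hα.add_mem_and_sub_mem_levelLE hu hy
  | zero => simp
  | add y z _ _ hy hz =>
    intro u hu
    rw [← add_assoc, ← sub_sub]
    exact ⟨(hz _ (hy u hu).1).1, (hz _ (hy u hu).2).2⟩
  | neg y _ hy =>
    intro u hu
    rw [← sub_eq_add_neg, sub_neg_eq_add]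
    exact (hy u hu).symm

theorem IsSLevel.one_add_mem_levelLE (hα : IsSLevel φ α) {y : D} (hy : y ∈ levelSpan φ α) :
    1 + y ∈ levelLE φ 0 :=
  hα.add_mem_levelLE ⟨1, rfl, by simp⟩ hy

theorem IsSLevel.one_notMem_levelSpan (hα : IsSLevel φ α) : (1 : D) ∉ levelSpan φ α := fun h ↦
  zero_notMem_levelLE (φ := φ) (by simpa using hα.one_add_mem_levelLE (neg_mem h))

end LevelSpan

section FractionField

variable {k : Type*} [Field k] [Infinite k] {M : Subgroup kˣ} [M.FiniteIndex] {Γ : Type*}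
  [AddGroup Γ] [PartialOrder Γ] [AddLeftMono Γ] {ψ : Additive M →+ Γ}

theorem exists_mul_mem_nonnegSubring (htot : ∀ a ∈ ψ.range, ∀ b ∈ ψ.range, a ≤ b ∨ b ≤ a) (c : k) :
    ∃ z : M, 0 ≤ ψ (Additive.ofMul z) ∧ ((z : kˣ) : k) * c ∈ nonnegSubring ψ := by
  have hmul {y z : M} (hy : 0 ≤ ψ (Additive.ofMul y)) (hz : 0 ≤ ψ (Additive.ofMul z)) :
      0 ≤ ψ (Additive.ofMul (y * z)) := by
    rw [ofMul_mul, map_add]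
    exact add_nonneg hy hz
  have hc : c ∈ Subring.closure ((fun u : kˣ ↦ (u : k)) '' M) :=
    subring_closure_eq_top_of_finiteIndex M ▸ Subring.mem_top c
  induction hc using Subring.closure_induction with
  | mem c hc =>
    obtain ⟨m, hm, rfl⟩ := hc
    rcases htot 0 (zero_mem _) (ψ (Additive.ofMul ⟨m, hm⟩)) ⟨_, rfl⟩ with h | h
    · exact ⟨1, by simp, by simpa using coe_mem_nonnegSubring h⟩
    · exact ⟨⟨m, hm⟩⁻¹, by rwa [ofMul_inv, map_neg, neg_nonneg], by simp⟩
  | zero => exact ⟨1, by simp, by simp⟩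
  | one => exact ⟨1, by simp, by simp⟩
  | add c d _ _ hc hd =>
    obtain ⟨y, hy, hyc⟩ := hc
    obtain ⟨z, hz, hzd⟩ := hd
    refine ⟨y * z, hmul hy hz, ?_⟩
    have h := add_mem (mul_mem (coe_mem_nonnegSubring hz) hyc)
      (mul_mem (coe_mem_nonnegSubring hy) hzd)
    convert h using 1
    push_cast
    ring
  | neg c _ hc =>
    obtain ⟨z, hz, hzc⟩ := hc
    exact ⟨z, hz, by simpa using hzc⟩
  | mul c d _ _ hc hd =>
    obtain ⟨y, hy, hyc⟩ := hc
    obtain ⟨z, hz, hzd⟩ := hd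
    exact ⟨y * z, hmul hy hz, by simpa [mul_mul_mul_comm] using mul_mem hyc hzd⟩

theorem isFractionRing_nonnegSubring (htot : ∀ a ∈ ψ.range, ∀ b ∈ ψ.range, a ≤ b ∨ b ≤ a) :
    IsFractionRing (nonnegSubring ψ) k := by
  refine IsFractionRing.of_field _ _ fun c ↦ ?_
  obtain ⟨z, hz, hzc⟩ := exists_mul_mem_nonnegSubring htot c
  exact ⟨⟨_, hzc⟩, ⟨_, coe_mem_nonnegSubring hz⟩, (mul_div_cancel_left₀ c z.1.ne_zero).symm⟩

end FractionField

section Restriction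

variable {k : Type*} [Field k] {D : Type*} [DivisionRing D] [Algebra k D] {N : Subgroup Dˣ}
  {Γ : Type*} [AddGroup Γ] [PartialOrder Γ] {φ : Additive N →+ Γ} {α : Γ}

theorem algebraMap_mem_nonnegSubring {c : k} (hc : c ∈ nonnegSubring (restrictBase k φ)) :
    algebraMap k D c ∈ nonnegSubring φ := by
  suffices h : nonnegSubring (restrictBase k φ) ≤ (nonnegSubring φ).comap (algebraMap k D) from h hc
  refine Subring.closure_le.2 ?_
  rintro _ ⟨m, rfl, hm⟩
  exact coe_mem_nonnegSubring (n := (unitsMap k).subgroupComap N m) hm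

theorem mem_levelLE_restrictBase {x : k} {β : Γ} (hx : algebraMap k D x ∈ levelLE φ β) :
    x ∈ levelLE (restrictBase k φ) β := by
  obtain ⟨n, hn, hnβ⟩ := hx
  have hx0 : x ≠ 0 := by
    rintro rfl
    exact (n : Dˣ).ne_zero (hn.trans (map_zero _))
  have hmap : unitsMap k (D := D) (Units.mk0 x hx0) = n := Units.ext hn.symm
  have hmem : Units.mk0 x hx0 ∈ interBase k N := Subgroup.mem_comap.2 (hmap ▸ n.2)
  have hres : (unitsMap k).subgroupComap N ⟨_, hmem⟩ = n := Subtype.ext hmap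
  refine ⟨⟨_, hmem⟩, rfl, ?_⟩
  change φ (Additive.ofMul ((unitsMap k).subgroupComap N ⟨_, hmem⟩)) ≤ β
  rwa [hres]

variable [Infinite k] [Algebra.IsAlgebraic k D] [(interBase k N).FiniteIndex] [AddLeftMono Γ]
  [AddRightMono Γ]

/- An element of `N_{> α}` is a root of a polynomial over the ring generated by `N_{≥ 0} ∩ k` with
non-zero constant term. -/
theorem IsSLevel.exists_ne_zero_algebraMap_mem_levelSpan (hα : IsSLevel φ α)
    (htot : ∀ a ∈ (restrictBase k φ).range, ∀ b ∈ (restrictBase k φ).range, a ≤ b ∨ b ≤ a) :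
    ∃ c : k, c ≠ 0 ∧ algebraMap k D c ∈ levelSpan φ α := by
  obtain ⟨hα0, ⟨_, n, rfl, hn⟩, -⟩ := hα
  set x : D := ((n : Dˣ) : D)
  have := isFractionRing_nonnegSubring htot
  have := IsLocalization.isAlgebraic k (nonZeroDivisors (nonnegSubring (restrictBase k φ)))
  have hx : IsAlgebraic (nonnegSubring (restrictBase k φ)) x :=
    (Algebra.IsAlgebraic.isAlgebraic (R := k) x).restrictScalars _
  obtain ⟨p, hp0, hp⟩ := hx.exists_nonzero_coeff_and_aeval_eq_zero
    (mem_nonZeroDivisors_of_ne_zero (n : Dˣ).ne_zero)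
  have haeval (q : (nonnegSubring (restrictBase k φ))[X]) : aeval x q ∈ nonnegSubring φ := by
    rw [aeval_eq_sum_range]
    refine sum_mem fun i _ ↦ ?_
    rw [Algebra.smul_def]
    exact mul_mem (algebraMap_mem_nonnegSubring (q.coeff i).2)
      (pow_mem (coe_mem_nonnegSubring (hα0.trans hn.le)) i)
  refine ⟨p.coeff 0, fun h ↦ hp0 (Subtype.ext h), ?_⟩
  have hroot : aeval x p.divX * x + algebraMap k D (p.coeff 0) = 0 := by
    rw [← hp]
    nth_rw 3 [← divX_mul_X_add p]
    simp only [map_add, map_mul, aeval_X, aeval_C]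
    rfl
  rw [eq_neg_of_add_eq_zero_right hroot]
  exact neg_mem (mul_mem_levelSpan (haeval _) (coe_mem_levelSpan hn))

theorem IsSLevel.exists_algebraMap_mem_levelSpan (hα : IsSLevel φ α)
    (htot : ∀ a ∈ (restrictBase k φ).range, ∀ b ∈ (restrictBase k φ).range, a ≤ b ∨ b ≤ a) :
    ∃ z : interBase k N, 0 ≤ restrictBase k φ (Additive.ofMul z) ∧
      algebraMap k D (z : kˣ) ∈ levelSpan φ α := by
  obtain ⟨c, hc0, hc⟩ := hα.exists_ne_zero_algebraMap_mem_levelSpan htot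
  obtain ⟨z, hz, hzc⟩ := exists_mul_mem_nonnegSubring htot c⁻¹
  refine ⟨z, hz, ?_⟩
  have h := mul_mem_levelSpan (algebraMap_mem_nonnegSubring hzc) hc
  rwa [← map_mul, inv_mul_cancel_right₀ hc0] at h

theorem IsSLevel.exists_isSLevel_restrictBase (hα : IsSLevel φ α)
    (htot : ∀ a ∈ (restrictBase k φ).range, ∀ b ∈ (restrictBase k φ).range, a ≤ b ∨ b ≤ a) :
    ∃ z, IsSLevel (restrictBase k φ) (restrictBase k φ z) := by
  obtain ⟨z, hz, hzα⟩ := hα.exists_algebraMap_mem_levelSpan htot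
  set ψ := restrictBase k φ
  have hmem {m : interBase k N} (hzm : ψ (Additive.ofMul z) ≤ ψ (Additive.ofMul m)) :
      algebraMap k D (m : kˣ) ∈ levelSpan φ α :=
    coe_mem_levelSpan_of_le (m := (unitsMap k).subgroupComap N z)
      (n := (unitsMap k).subgroupComap N m) hzα hzm
  have hpos : 0 < ψ (Additive.ofMul z) := by
    refine hz.lt_of_ne fun h ↦ hα.one_notMem_levelSpan ?_
    simpa using hmem (m := 1) (by simp [← h])
  refine ⟨Additive.ofMul z, hz, ⟨_, z * z, rfl, ?_⟩, ?_⟩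
  · rw [ofMul_mul, map_add]
    exact lt_add_of_pos_left _ hpos
  rintro _ ⟨m, rfl, hm⟩
  constructor
  · refine mem_levelLE_restrictBase ?_
    simpa using hα.one_add_mem_levelLE (hmem hm.le)
  · refine mem_levelLE_restrictBase ?_
    simpa [sub_eq_add_neg] using hα.one_add_mem_levelLE (neg_mem (hmem hm.le))

end Restriction

section PowIndex

variable {k : Type*} [Field k] {M : Subgroup kˣ} {Γ : Type*} [AddGroup Γ]
  {ψ : Additive M →+ Γ}

/-- The map `x ↦ ψ (x ^ e)` on `kˣ`, where `e` is the index of `M`. It extends `e • ψ`, and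
when the image of `ψ` is totally ordered its `nonnegSubring` is a valuation ring. -/
noncomputable def powIndex (ψ : Additive M →+ Γ) : Additive (⊤ : Subgroup kˣ) →+ Γ :=
  ψ.comp (MonoidHom.toAdditive
    (((powMonoidHom M.index).codRestrict M fun x ↦ M.pow_index_mem x).comp (Subgroup.subtype ⊤)))

theorem powIndex_inclusion (m : M) :
    powIndex ψ (Additive.ofMul (Subgroup.inclusion le_top m)) = M.index • ψ (Additive.ofMul m) := by
  rw [← map_nsmul, ← ofMul_pow]
  rfl

theorem range_powIndex_le : (powIndex ψ).range ≤ ψ.range := by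
  rintro _ ⟨x, rfl⟩
  exact ⟨_, rfl⟩

variable [PartialOrder Γ] [AddLeftMono Γ]

theorem mem_or_inv_mem_nonnegSubring {χ : Additive (⊤ : Subgroup kˣ) →+ Γ}
    (htot : ∀ a ∈ χ.range, ∀ b ∈ χ.range, a ≤ b ∨ b ≤ a) (x : k) :
    x ∈ nonnegSubring χ ∨ x⁻¹ ∈ nonnegSubring χ := by
  rcases eq_or_ne x 0 with rfl | hx
  · exact .inl (zero_mem _)
  let u : (⊤ : Subgroup kˣ) := ⟨Units.mk0 x hx, Subgroup.mem_top _⟩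
  refine (htot 0 (zero_mem _) (χ (Additive.ofMul u)) ⟨_, rfl⟩).imp coe_mem_nonnegSubring fun h ↦ ?_
  have hinv : 0 ≤ χ (Additive.ofMul u⁻¹) := by rwa [ofMul_inv, map_neg, neg_nonneg]
  simpa [u] using coe_mem_nonnegSubring hinv

variable [AddRightMono Γ]

theorem lt_of_powIndex_mul_inclusion_lt (htot : ∀ a ∈ ψ.range, ∀ b ∈ ψ.range, a ≤ b ∨ b ≤ a)
    {c : (⊤ : Subgroup kˣ)} {m n : M}
    (h : powIndex ψ (Additive.ofMul (c * Subgroup.inclusion le_top m)) <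
      powIndex ψ (Additive.ofMul (c * Subgroup.inclusion le_top n))) :
    ψ (Additive.ofMul m) < ψ (Additive.ofMul n) := by
  simp only [ofMul_mul, map_add, powIndex_inclusion, add_lt_add_iff_left] at h
  have hnle : ¬ ψ (Additive.ofMul n) ≤ ψ (Additive.ofMul m) := fun hle ↦
    h.not_ge (nsmul_le_nsmul_right hle _)
  exact ((htot _ ⟨_, rfl⟩ _ ⟨_, rfl⟩).resolve_left hnle).lt_of_not_ge hnle

variable [Infinite k] [M.FiniteIndex] {α : Γ}

/- On the coset `c M`, choose `z ∈ M` such that `z c` lies in the subring generated by `M_{≥ 0}`;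
for `x = (z c) (m z⁻¹)` to lie in the span of `M_{> α}` it is then enough that `ψ m` be large
compared with `ψ z`, and there are only finitely many cosets. -/
theorem exists_levelSpan_powIndex_le (hα : (levelGT ψ α).Nonempty)
    (htot : ∀ a ∈ ψ.range, ∀ b ∈ ψ.range, a ≤ b ∨ b ≤ a) :
    ∃ t, levelSpan (powIndex ψ) (powIndex ψ t) ≤ levelSpan ψ α := by
  obtain ⟨_, n, rfl, hn⟩ := hα
  choose z _ hz using exists_mul_mem_nonnegSubring htot
  have hdir : Directed (· ≤ ·) (powIndex ψ) := fun a b ↦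
    (htot _ (range_powIndex_le ⟨a, rfl⟩) _ (range_powIndex_le ⟨b, rfl⟩)).elim
      (fun h ↦ ⟨b, h, le_rfl⟩) fun h ↦ ⟨a, le_rfl, h⟩
  let rep (q : kˣ ⧸ M) : (⊤ : Subgroup kˣ) := ⟨q.out, Subgroup.mem_top _⟩
  obtain ⟨t, ht⟩ := hdir.finite_le fun q ↦
    Additive.ofMul (rep q * Subgroup.inclusion le_top (n * z (q.out : kˣ)))
  refine ⟨t, (AddSubgroup.closure_le _).2 ?_⟩
  rintro _ ⟨x, rfl, hxt⟩
  obtain ⟨q, m, rfl⟩ : ∃ q, ∃ m : M, x = rep q * Subgroup.inclusion le_top m := by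
    obtain ⟨m, hm⟩ := QuotientGroup.mk_out_eq_mul M x
    exact ⟨(x : kˣ), m⁻¹, Subtype.ext (by simp [rep, hm])⟩
  set c : kˣ := q.out
  have hnz : ψ (Additive.ofMul (n * z c)) < ψ (Additive.ofMul m) :=
    lt_of_powIndex_mul_inclusion_lt htot ((ht q).trans_lt hxt)
  have hquot : α < ψ (Additive.ofMul (m * (z c)⁻¹)) := by
    rw [ofMul_mul, ofMul_inv, map_add, map_neg, ← sub_eq_add_neg]
    refine hn.trans (lt_sub_iff_add_lt.2 ?_)
    rwa [← map_add, ← ofMul_mul]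
  have hprod : ((rep q * Subgroup.inclusion le_top m : kˣ) : k) =
      (z c : kˣ) * c * ((m * (z c)⁻¹ : M) : kˣ) := by
    simp only [rep, c, Subgroup.coe_mul, Subgroup.coe_inclusion, Units.val_mul,
      InvMemClass.coe_inv, Units.val_inv_eq_inv_val]
    field_simp
  exact hprod ▸ mul_mem_levelSpan (hz c) (coe_mem_levelSpan hquot)

theorem IsSLevel.exists_valuationSubring (hα : IsSLevel ψ α)
    (htot : ∀ a ∈ ψ.range, ∀ b ∈ ψ.range, a ≤ b ∨ b ≤ a) :
    ∃ R : ValuationSubring k, R ≠ ⊤ ∧ (∀ m : M, 0 ≤ ψ (Additive.ofMul m) → ((m : kˣ) : k) ∈ R) ∧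
      ∃ t : kˣ, ∀ r ∈ R, ∀ x : kˣ, (x : k) = 1 + r * t → x ∈ M := by
  obtain ⟨s, hs⟩ := exists_levelSpan_powIndex_le hα.2.1 htot
  obtain ⟨_, n, rfl, hn⟩ := hα.2.1
  let R : ValuationSubring k := .ofSubring (nonnegSubring (powIndex ψ)) <|
    mem_or_inv_mem_nonnegSubring fun a ha b hb ↦
      htot a (range_powIndex_le ha) b (range_powIndex_le hb)
  have hpos : 0 < powIndex ψ (Additive.ofMul (Subgroup.inclusion le_top n)) := by
    rw [powIndex_inclusion]
    exact nsmul_pos (hα.1.trans_lt hn) Subgroup.FiniteIndex.index_ne_zero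
  let t : (⊤ : Subgroup kˣ) := s.toMul * Subgroup.inclusion le_top n
  have ht : ((t : kˣ) : k) ∈ levelSpan (powIndex ψ) (powIndex ψ s) :=
    coe_mem_levelSpan ((lt_add_of_pos_right _ hpos).trans_eq (map_add _ _ _).symm)
  have hRt {r : k} (hr : r ∈ R) : r * (t : kˣ) ∈ levelSpan ψ α := hs (mul_mem_levelSpan hr ht)
  refine ⟨R, ?_, ?_, t, fun r hr x hx ↦ ?_⟩
  · intro hR
    refine hα.one_notMem_levelSpan ?_
    simpa using hRt (r := ((t : kˣ) : k)⁻¹) (hR ▸ ValuationSubring.mem_top _)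
  · intro m hm
    refine coe_mem_nonnegSubring (φ := powIndex ψ) (n := Subgroup.inclusion le_top m) ?_
    rw [powIndex_inclusion]
    exact nsmul_nonneg hm _
  · obtain ⟨m, hm, -⟩ := hα.one_add_mem_levelLE (hRt hr)
    rw [← hx] at hm
    exact Units.ext hm ▸ m.2

end PowIndex

theorem isAdicallyOpen_of_le {k : Type*} [Field k] {R V : ValuationSubring k} (hRV : R ≤ V)
    {M : Subgroup kˣ} {t : kˣ} (h : ∀ r ∈ R, ∀ x : kˣ, (x : k) = 1 + r * t → x ∈ M) :
    IsAdicallyOpen V.valuation (M : Set kˣ) := by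
  refine isAdicallyOpen_of_forall_sub_one_lt t.ne_zero fun x hx ↦ ?_
  have hpos : 0 < V.valuation (t : k) := by simp [zero_lt_iff]
  have hr : ((x : k) - 1) / t ∈ V.nonunits := by
    rwa [ValuationSubring.mem_nonunits_iff, map_div₀, div_lt_one₀ hpos]
  refine h _ (R.nonunits_le (ValuationSubring.nonunits_le_nonunits.2 hRV hr)) x ?_
  rw [div_mul_cancel₀ _ t.ne_zero, add_sub_cancel]

theorem finiteIndex_interBase (k : Type*) [Field k] {D : Type*} [DivisionRing D] [Algebra k D]
    (N : Subgroup Dˣ) [N.FiniteIndex] : (interBase k N).FiniteIndex where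
  index_ne_zero := by
    rw [interBase, Subgroup.index_comap]
    exact Subgroup.FiniteIndex.index_ne_zero

end LeveledMap

theorem mainTheorem5_general {k : Type u} [Field k]
    (hk : Algebra.trdeg (⊥ : Subfield k) k < Cardinal.aleph0)
    {D : Type v} [DivisionRing D] [Algebra k D] [Algebra.IsAlgebraic k D]
    (N : Subgroup Dˣ) [(LeveledMap.interBase k N).FiniteIndex]
    {Γ : Type w} [AddGroup Γ] [PartialOrder Γ] [AddLeftMono Γ] [AddRightMono Γ]
    (φ : Additive N →+ Γ) (hφ : LeveledMap.IsStronglyLeveled φ)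
    (htot : ∀ a ∈ (LeveledMap.restrictBase k φ).range, ∀ b ∈ (LeveledMap.restrictBase k φ).range,
      a ≤ b ∨ b ≤ a) :
    LeveledMap.IsStrongValuationLike (LeveledMap.restrictBase k φ).rangeRestrict ∧
    ∃ (Γ₀ : Type u) (_ : LinearOrderedCommGroupWithZero Γ₀) (v : Valuation k Γ₀),
      Function.Surjective v ∧
      LeveledMap.height Γ₀ˣ = 1 ∧
      LeveledMap.IsAssociated v (LeveledMap.restrictBase k φ) ∧
      LeveledMap.IsAdicallyOpen v (LeveledMap.interBase k N : Set kˣ) := by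
  obtain ⟨α, hα⟩ := hφ
  have := hα.infinite_of_isAlgebraic k
  obtain ⟨z, hz⟩ := hα.exists_isSLevel_restrictBase htot
  refine ⟨⟨fun a b ↦ htot a a.2 b b.2, ⟨_, z, rfl⟩, hz⟩, ?_⟩
  obtain ⟨R, hR, hassoc, t, ht⟩ := hz.exists_valuationSubring htot
  obtain ⟨V, hRV, hV⟩ := LeveledMap.exists_le_isCoatom hk hR
  have := LeveledMap.mulArchimedean_valueGroup_of_isCoatom hV
  have := LeveledMap.nontrivial_units_valueGroup hV.1
  refine ⟨V.ValueGroup, inferInstance, V.valuation, V.valuation_surjective,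
    LeveledMap.height_eq_one, fun m hm ↦ ?_, LeveledMap.isAdicallyOpen_of_le hRV ht⟩
  exact (V.valuation_le_one_iff _).2 (hRV (hassoc m hm))

theorem mainTheorem5 {k : Type u} [Field k]
    (hk : Algebra.trdeg (⊥ : Subfield k) k < Cardinal.aleph0)
    {D : Type v} [DivisionRing D] [Algebra k D] [FiniteDimensional k D]
    (N : Subgroup Dˣ) (hNnormal : N.Normal) (hNfin : N.FiniteIndex) (hN1 : (-1 : Dˣ) ∈ N)
    {Γ : Type w} [AddGroup Γ] [PartialOrder Γ] [AddLeftMono Γ] [AddRightMono Γ]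
    (φ : Additive N →+ Γ) (hφ : LeveledMap.IsStronglyLeveled φ)
    (htot : ∀ a ∈ (LeveledMap.restrictBase k φ).range, ∀ b ∈ (LeveledMap.restrictBase k φ).range,
      a ≤ b ∨ b ≤ a) :
    LeveledMap.IsStrongValuationLike (LeveledMap.restrictBase k φ).rangeRestrict ∧
    ∃ (Γ₀ : Type u) (_ : LinearOrderedCommGroupWithZero Γ₀) (v : Valuation k Γ₀),
      Function.Surjective v ∧
      LeveledMap.height Γ₀ˣ = 1 ∧
      LeveledMap.IsAssociated v (LeveledMap.restrictBase k φ) ∧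
      LeveledMap.IsAdicallyOpen v (LeveledMap.interBase k N : Set kˣ) := by
  have := LeveledMap.finiteIndex_interBase k N
  exact mainTheorem5_general hk N φ hφ htot
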